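/- Let $M=(M_p)_{p\in\mathbb{N}_0}$ be a weight sequence, that is, a sequence of positive real numbers with $M_0=1$ which is log-convex ($M_p^2\le M_{p-1}M_{p+1}$ for all $p\ge 1$) and whose quotients $m_p:=M_{p+1}/M_p$ tend to $\infty$ as $p\to\infty$. Put $$\gamma(M):=\sup\{\mu>0 : (m_p/(p+1)^{\mu})_p \text{ is almost increasing}\}\in[0,\infty],$$ with $\sup\emptyset:=0$, where $(c_p)_p$ is almost increasing if there is $a>0$ such that $c_p\le a\,c_q$ whenever $p\le q$. Suppose that $\gamma(M)>0$. Let $C_{\{M\}}(0,\infty)$ be the set of all continuous functions $\varphi:(0,\infty)\to\mathbb{C}$ such that, for some $h>0$, $$\sup_{p\in\mathbb{N}_0}\,\sup_{x>0}\frac{x^p|\varphi(x)|}{h^pM_p}<\infty,$$ and let $\Lambda_{\{M\}}$ be the set of all complex sequences $(c_p)_{p\in\mathbb{N}_0}$ such that $\sup_{p}|c_p|/(h^pM_p)<\infty$ for some $h>0$. Then for every $\varphi\in C_{\{M\}}(0,\infty)$ and $p\in\mathbb{N}_0$ the moment integral $\mu_p(\varphi):=\int_0^\infty x^p\varphi(x)\,dx$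 converges absolutely, and the Stieltjes moment mapping $\mathcal{M}:\varphi\mapsto(\mu_p(\varphi))_{p\in\mathbb{N}_0}$ satisfies $$\mathcal{M}(C_{\{M\}}(0,\infty))\subset\Lambda_{\{M\}}$$ if and only if $M$ is derivation closed, i.e. there are $C_0>0$ and $H>1$ such that $M_{p+1}\le C_0H^{p+1}M_p$ for all $p\in\mathbb{N}_0$. -/

import Mathlib

noncomputable section

namespace StieltjesMoment

/-- The sequence of quotients `m_p = M_{p+1} / M_p`. -/
def quot (M : ℕ → ℝ) (p : ℕ) : ℝ := M (p + 1) / M p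

/-- Weight sequences: sequences of positive reals with `M_0 = 1` that are log-convex and whose
quotients `m_p` (nondecreasing by log-convexity) tend to infinity. -/
structure IsWeightSequence (M : ℕ → ℝ) : Prop where
  pos : ∀ p, 0 < M p
  zero : M 0 = 1
  logConvex : ∀ p, M (p + 1) ^ 2 ≤ M p * M (p + 2)
  quot_tendsto : Filter.Tendsto (quot M) Filter.atTop Filter.atTop

/-- Derivation closedness (dc). -/
def IsDerivationClosed (M : ℕ → ℝ) : Prop :=
  ∃ C₀ H : ℝ, 0 < C₀ ∧ 1 < H ∧ ∀ p : ℕ, M (p + 1) ≤ C₀ * H ^ (p + 1) * M p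

/-- Almost increasing sequences. -/
def IsAlmostIncreasing (c : ℕ → ℝ) : Prop :=
  ∃ a : ℝ, 0 < a ∧ ∀ p q : ℕ, p ≤ q → c p ≤ a * c q

/-- The index `γ(M) ∈ [0, ∞]`: the supremum of all `μ > 0` such that `(m_p / (p+1)^μ)_p` is
almost increasing (it is `0` if there is no such `μ`). -/
def gammaIndex (M : ℕ → ℝ) : ENNReal :=
  ⨆ (μ : ℝ) (_ : 0 < μ ∧ IsAlmostIncreasing (fun p : ℕ => quot M p / ((p : ℝ) + 1) ^ μ)),
    ENNReal.ofReal μ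

/-- The space `C_{M,h}(0,∞)`: the continuous `φ : (0,∞) → ℂ` for which the supremum over
`p ∈ ℕ` and `x > 0` of `x^p |φ(x)| / (h^p M_p)` is finite. -/
def CSpaceAt (M : ℕ → ℝ) (h : ℝ) : Set C(Set.Ioi (0 : ℝ), ℂ) :=
  {φ | BddAbove (Set.range fun z : ℕ × Set.Ioi (0 : ℝ) =>
    (z.2 : ℝ) ^ z.1 * ‖φ z.2‖ / (h ^ z.1 * M z.1))}

/-- The space `C_{{M}}(0,∞)`, the union of the `C_{M,h}(0,∞)` over `h > 0`. -/
def CSpace (M : ℕ → ℝ) : Set C(Set.Ioi (0 : ℝ), ℂ) :=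
  ⋃ (h : ℝ) (_ : 0 < h), CSpaceAt M h

/-- The space `Λ_{M,h}` of complex sequences with `sup_p |c_p| / (h^p M_p) < ∞`. -/
def LambdaAt (M : ℕ → ℝ) (h : ℝ) : Set (ℕ → ℂ) :=
  {c | BddAbove (Set.range fun p : ℕ => ‖c p‖ / (h ^ p * M p))}

/-- The space `Λ_{{M}}`, the union of the `Λ_{M,h}` over `h > 0`. -/
def Lambda (M : ℕ → ℝ) : Set (ℕ → ℂ) :=
  ⋃ (h : ℝ) (_ : 0 < h), LambdaAt M h

/-- Lebesgue measure on the subtype `(0,∞)`. -/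
def halfLineMeasure : MeasureTheory.Measure (Set.Ioi (0 : ℝ)) :=
  (MeasureTheory.volume : MeasureTheory.Measure ℝ).comap Subtype.val

/-- The Stieltjes moment mapping `φ ↦ (∫_0^∞ x^p φ(x) dx)_p`. -/
def momentMap (φ : C(Set.Ioi (0 : ℝ), ℂ)) (p : ℕ) : ℂ :=
  ∫ x : Set.Ioi (0 : ℝ), ((x : ℝ) : ℂ) ^ p * φ x ∂halfLineMeasure

end StieltjesMoment

end

/-!
A function `φ` with `x ^ p |φ x| ≤ C h ^ p M_p` for all `p` satisfies
`(1 + x²) x ^ p |φ x| ≤ C (h ^ p M_p + h ^ (p + 2) M_{p + 2})`, so its moments converge absolutely and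
are bounded by a multiple of the right-hand side (`norm_pow_mul_le`, `integrable_moment`,
`norm_momentMap_le`). If `M` is derivation closed, `M_{p + 2}` is at most geometrically larger than
`M_p`, and the moment sequence lies in `Λ_{M}`.

Conversely, the moments of a single function force derivation closedness. Let
`F x = ∑ j, x ^ j / (2 ^ j M_j)` and `φ = 1 / F`. Dropping all but one term of `F` shows that `φ`
belongs to `C_{M}(0,∞)`. By log-convexity, `x ^ j / M_j` is maximal at `j = p + 1` whenever
`m_p ≤ x ≤ m_{p + 1}`, so there `F x ≤ 2 x ^ (p + 1) / M_{p + 1}`, and the moment of order `p + 1` of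
`φ` is at least `M_{p + 1} (m_{p + 1} - m_p) / 2` (`le_norm_momentMap_invSeries`). If the moments lie
in `Λ_{M}`, the increments of `m` therefore grow at most geometrically, hence so does `m`, which is
derivation closedness.
-/

open MeasureTheory Filter

namespace StieltjesMoment

/-! ### Absolute convergence and upper bounds for the moments -/

lemma norm_pow_mul_le {M : ℕ → ℝ} (hpos : ∀ p, 0 < M p) {h : ℝ} (hh : 0 < h)
    {φ : C(Set.Ioi (0 : ℝ), ℂ)} (hφ : φ ∈ CSpaceAt M h) :
    ∃ C : ℝ, 0 ≤ C ∧ ∀ (p : ℕ) (x : Set.Ioi (0 : ℝ)),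
      ‖((x : ℝ) : ℂ) ^ p * φ x‖ ≤
        C * (h ^ p * M p + h ^ (p + 2) * M (p + 2)) * (1 + (x : ℝ) ^ 2)⁻¹ := by
  obtain ⟨C, hC⟩ := hφ
  have key : ∀ (p : ℕ) (x : Set.Ioi (0 : ℝ)), (x : ℝ) ^ p * ‖φ x‖ ≤ C * (h ^ p * M p) := by
    intro p x
    have h1 := hC ⟨(p, x), rfl⟩
    rwa [div_le_iff₀ (mul_pos (pow_pos hh p) (hpos p))] at h1
  have hC0 : 0 ≤ C := by
    have h1 := key 0 ⟨1, Set.mem_Ioi.2 one_pos⟩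
    have h2 := hpos 0
    simp only [pow_zero, one_mul] at h1
    exact nonneg_of_mul_nonneg_left ((norm_nonneg _).trans h1) h2
  refine ⟨C, hC0, fun p x => ?_⟩
  have hx : 0 < (x : ℝ) := x.2
  rw [← div_eq_mul_inv, le_div_iff₀ (by positivity), norm_mul, norm_pow, Complex.norm_real,
    Real.norm_of_nonneg hx.le]
  calc (x : ℝ) ^ p * ‖φ x‖ * (1 + (x : ℝ) ^ 2)
      = (x : ℝ) ^ p * ‖φ x‖ + (x : ℝ) ^ (p + 2) * ‖φ x‖ := by ring
    _ ≤ C * (h ^ p * M p) + C * (h ^ (p + 2) * M (p + 2)) := add_le_add (key _ _) (key _ _)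
    _ = _ := by ring

lemma integrable_inv_one_add_sq_halfLine :
    Integrable (fun x : Set.Ioi (0 : ℝ) => (1 + (x : ℝ) ^ 2)⁻¹) halfLineMeasure :=
  (integrableOn_iff_comap_subtypeVal measurableSet_Ioi).1 integrable_inv_one_add_sq.integrableOn

lemma integrable_moment {M : ℕ → ℝ} (hpos : ∀ p, 0 < M p) {φ : C(Set.Ioi (0 : ℝ), ℂ)}
    (hφ : φ ∈ CSpace M) (p : ℕ) :
    Integrable (fun x : Set.Ioi (0 : ℝ) => ((x : ℝ) : ℂ) ^ p * φ x) halfLineMeasure := by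
  simp only [CSpace, Set.mem_iUnion] at hφ
  obtain ⟨h, hh, hφ⟩ := hφ
  obtain ⟨C, -, hC⟩ := norm_pow_mul_le hpos hh hφ
  refine (integrable_inv_one_add_sq_halfLine.const_mul
    (C * (h ^ p * M p + h ^ (p + 2) * M (p + 2)))).mono' ?_ (ae_of_all _ (hC p))
  exact Continuous.aestronglyMeasurable (by fun_prop)

lemma norm_momentMap_le {M : ℕ → ℝ} (hpos : ∀ p, 0 < M p) {h : ℝ} (hh : 0 < h)
    {φ : C(Set.Ioi (0 : ℝ), ℂ)} (hφ : φ ∈ CSpaceAt M h) :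
    ∃ C : ℝ, 0 ≤ C ∧ ∀ p : ℕ,
      ‖momentMap φ p‖ ≤ C * (h ^ p * M p + h ^ (p + 2) * M (p + 2)) := by
  obtain ⟨C, hC0, hC⟩ := norm_pow_mul_le hpos hh hφ
  refine ⟨C * ∫ x : Set.Ioi (0 : ℝ), (1 + (x : ℝ) ^ 2)⁻¹ ∂halfLineMeasure,
    mul_nonneg hC0 (integral_nonneg fun x => by positivity), fun p => ?_⟩
  have h1 := norm_integral_le_of_norm_le (integrable_inv_one_add_sq_halfLine.const_mul
    (C * (h ^ p * M p + h ^ (p + 2) * M (p + 2)))) (ae_of_all _ (hC p))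
  rw [integral_const_mul] at h1
  exact h1.trans_eq (by ring)

lemma image_momentMap_subset {M : ℕ → ℝ} (hpos : ∀ p, 0 < M p) (hdc : IsDerivationClosed M) :
    momentMap '' CSpace M ⊆ Lambda M := by
  rintro _ ⟨φ, hφ, rfl⟩
  simp only [CSpace, Set.mem_iUnion] at hφ
  obtain ⟨h, hh, hφ⟩ := hφ
  obtain ⟨C, hC0, hC⟩ := norm_momentMap_le hpos hh hφ
  obtain ⟨D, H, hD, hH, hdc⟩ := hdc
  have hH0 : 0 < H := one_pos.trans hH
  have hM2 : ∀ p, M (p + 2) ≤ D ^ 2 * H ^ 3 * (H ^ 2) ^ p * M p := fun p =>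
    calc M (p + 2) ≤ D * H ^ (p + 1 + 1) * M (p + 1) := hdc (p + 1)
      _ ≤ D * H ^ (p + 1 + 1) * (D * H ^ (p + 1) * M p) := by gcongr; exact hdc p
      _ = _ := by ring
  simp only [Lambda, Set.mem_iUnion]
  refine ⟨h * H ^ 2, by positivity, C * (1 + h ^ 2 * (D ^ 2 * H ^ 3)), ?_⟩
  rintro _ ⟨p, rfl⟩
  have hp := hpos p
  have hone : 1 ≤ (H ^ 2) ^ p := one_le_pow₀ (one_le_pow₀ hH.le)
  dsimp only
  rw [div_le_iff₀ (by positivity)]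
  calc ‖momentMap φ p‖ ≤ C * (h ^ p * M p + h ^ (p + 2) * M (p + 2)) := hC p
    _ ≤ C * (h ^ p * M p * (H ^ 2) ^ p
          + h ^ (p + 2) * (D ^ 2 * H ^ 3 * (H ^ 2) ^ p * M p)) := by
        refine mul_le_mul_of_nonneg_left (add_le_add ?_ ?_) hC0
        · exact le_mul_of_one_le_right (by positivity) hone
        · exact mul_le_mul_of_nonneg_left (hM2 p) (by positivity)
    _ = _ := by ring

/-! ### The reciprocal of an entire series with coefficients `1 / (2 ^ j M_j)` -/

namespace IsWeightSequence

variable {M : ℕ → ℝ} (hM : IsWeightSequence M)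
include hM

lemma quot_pos (p : ℕ) : 0 < quot M p := div_pos (hM.pos _) (hM.pos _)

lemma quot_monotone : Monotone (quot M) := by
  refine monotone_nat_of_le_succ fun p => ?_
  rw [quot, quot, div_le_div_iff₀ (hM.pos _) (hM.pos _)]
  nlinarith [hM.logConvex p]

lemma succ_eq (p : ℕ) : M (p + 1) = quot M p * M p :=
  (div_mul_cancel₀ _ (hM.pos p).ne').symm

/-- For `m_p ≤ x ≤ m_{p+1}` the sequence `j ↦ x ^ j / M_j` increases up to `j = p + 1` and
decreases from there on, since its consecutive quotients are `x / m_j`. -/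
lemma pow_div_le {p : ℕ} {x : ℝ} (h1 : quot M p ≤ x) (h2 : x ≤ quot M (p + 1)) (j : ℕ) :
    x ^ j / M j ≤ x ^ (p + 1) / M (p + 1) := by
  have hx : 0 < x := (hM.quot_pos p).trans_le h1
  have step : ∀ j, x ^ (j + 1) / M (j + 1) = x ^ j / M j * (x / quot M j) := fun j => by
    rw [hM.succ_eq j, pow_succ, div_mul_div_comm, mul_comm (M j)]
  have hnn : ∀ j, 0 ≤ x ^ j / M j := fun j => (div_pos (pow_pos hx j) (hM.pos j)).le
  rcases le_total j (p + 1) with hj | hj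
  · induction hj using Nat.decreasingInduction with
    | self => exact le_rfl
    | of_succ k hk ih =>
      refine le_trans ?_ ih
      rw [step]
      refine le_mul_of_one_le_right (hnn k) ?_
      rw [one_le_div (hM.quot_pos k)]
      exact (hM.quot_monotone (Nat.lt_succ_iff.1 hk)).trans h1
  · induction j, hj using Nat.le_induction with
    | base => exact le_rfl
    | succ k hk ih =>
      refine le_trans ?_ ih
      rw [step]
      refine mul_le_of_le_one_right (hnn k) ?_
      rw [div_le_one (hM.quot_pos k)]
      exact h2.trans (hM.quot_monotone hk)

lemma summable_pow_div {x : ℝ} (hx : 0 < x) : Summable fun j : ℕ => x ^ j / (2 ^ j * M j) := by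
  have hne : ∀ j, 0 < x ^ j / (2 ^ j * M j) := fun j =>
    div_pos (pow_pos hx j) (mul_pos (by positivity) (hM.pos j))
  refine summable_of_ratio_test_tendsto_lt_one (l := 0) one_pos
    (Eventually.of_forall fun j => (hne j).ne') ?_
  have : (fun j : ℕ => ‖x ^ (j + 1) / (2 ^ (j + 1) * M (j + 1))‖ / ‖x ^ j / (2 ^ j * M j)‖)
      = fun j => x / 2 / quot M j := by
    funext j
    rw [Real.norm_of_nonneg (hne _).le, Real.norm_of_nonneg (hne _).le, hM.succ_eq j]
    have := (hM.pos j).ne'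
    have := (hM.quot_pos j).ne'
    field_simp
    ring
  rw [this]
  exact hM.quot_tendsto.const_div_atTop _

lemma continuousOn_series :
    ContinuousOn (fun x : ℝ => ∑' j : ℕ, x ^ j / (2 ^ j * M j)) (Set.Ioi 0) := by
  intro x hx
  have hx : 0 < x := hx
  have hc : ContinuousOn (fun x : ℝ => ∑' j : ℕ, x ^ j / (2 ^ j * M j)) (Set.Icc 0 (x + 1)) := by
    refine continuousOn_tsum (fun j => by fun_prop)
      (hM.summable_pow_div (x := x + 1) (by positivity)) ?_
    intro j y hy
    have hj := hM.pos j
    have hy0 := hy.1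
    rw [Real.norm_of_nonneg (by positivity)]
    gcongr
    exact hy.2
  exact (hc.continuousAt (Icc_mem_nhds hx (by linarith))).continuousWithinAt

lemma term_le_series {x : ℝ} (hx : 0 < x) (p : ℕ) :
    x ^ p / (2 ^ p * M p) ≤ ∑' j : ℕ, x ^ j / (2 ^ j * M j) :=
  (hM.summable_pow_div hx).le_tsum p fun j _ => by
    have := hM.pos j
    positivity

lemma series_pos {x : ℝ} (hx : 0 < x) : 0 < ∑' j : ℕ, x ^ j / (2 ^ j * M j) :=
  lt_of_lt_of_le (by have := hM.pos 0; positivity) (hM.term_le_series hx 0)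

lemma series_le {p : ℕ} {x : ℝ} (h1 : quot M p ≤ x) (h2 : x ≤ quot M (p + 1)) :
    ∑' j : ℕ, x ^ j / (2 ^ j * M j) ≤ 2 * (x ^ (p + 1) / M (p + 1)) := by
  have hx : 0 < x := (hM.quot_pos p).trans_le h1
  calc ∑' j : ℕ, x ^ j / (2 ^ j * M j)
      ≤ ∑' j : ℕ, (1 / 2 : ℝ) ^ j * (x ^ (p + 1) / M (p + 1)) := by
        refine (hM.summable_pow_div hx).tsum_le_tsum (fun j => ?_)
          (summable_geometric_two.mul_right _)
        calc x ^ j / (2 ^ j * M j) = (1 / 2 : ℝ) ^ j * (x ^ j / M j) := by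
              rw [one_div, inv_pow, div_mul_eq_div_div_swap]; ring
          _ ≤ _ := mul_le_mul_of_nonneg_left (hM.pow_div_le h1 h2 j) (by positivity)
    _ = _ := by rw [tsum_mul_right, tsum_geometric_two]

/-- The function `x ↦ 1 / ∑ j, x ^ j / (2 ^ j M_j)` on `(0,∞)`. -/
noncomputable def invSeries : C(Set.Ioi (0 : ℝ), ℂ) where
  toFun x := (((∑' j : ℕ, (x : ℝ) ^ j / (2 ^ j * M j))⁻¹ : ℝ) : ℂ)
  continuous_toFun := by
    refine Complex.continuous_ofReal.comp (Continuous.inv₀ ?_ fun x => (hM.series_pos x.2).ne')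
    exact continuousOn_iff_continuous_domRestrict.1 hM.continuousOn_series

lemma invSeries_apply (x : Set.Ioi (0 : ℝ)) :
    hM.invSeries x = (((∑' j : ℕ, (x : ℝ) ^ j / (2 ^ j * M j))⁻¹ : ℝ) : ℂ) := rfl

lemma invSeries_mem : hM.invSeries ∈ CSpace M := by
  simp only [CSpace, Set.mem_iUnion]
  refine ⟨2, two_pos, 1, ?_⟩
  rintro _ ⟨⟨p, x⟩, rfl⟩
  have hp := hM.pos p
  have hF := hM.series_pos x.2
  have h1 := hM.term_le_series x.2 p
  dsimp only
  rw [hM.invSeries_apply, Complex.norm_real, Real.norm_of_nonneg (inv_nonneg.2 hF.le),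
    ← div_eq_mul_inv, div_div, mul_comm, ← div_div, div_le_one hF]
  exact h1

lemma le_norm_momentMap_invSeries (p : ℕ) :
    M (p + 1) * (quot M (p + 1) - quot M p) / 2 ≤ ‖momentMap hM.invSeries (p + 1)‖ := by
  set g : ℝ → ℝ := fun x => x ^ (p + 1) * (∑' j : ℕ, x ^ j / (2 ^ j * M j))⁻¹ with hg
  have hfun : (fun x : Set.Ioi (0 : ℝ) => ((x : ℝ) : ℂ) ^ (p + 1) * hM.invSeries x)
      = fun x : Set.Ioi (0 : ℝ) => ((g x : ℝ) : ℂ) := by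
    funext x
    rw [hM.invSeries_apply]
    push_cast [hg]
    rfl
  have hint := integrable_moment hM.pos hM.invSeries_mem (p + 1)
  rw [hfun] at hint
  have hgint : IntegrableOn g (Set.Ioi 0) :=
    (integrableOn_iff_comap_subtypeVal measurableSet_Ioi).2 hint.re
  have hmom : momentMap hM.invSeries (p + 1) = ((∫ x in Set.Ioi 0, g x : ℝ) : ℂ) := by
    rw [momentMap, hfun, integral_complex_ofReal]
    congr 1
    exact integral_subtype_comap measurableSet_Ioi g
  have hsub : Set.Icc (quot M p) (quot M (p + 1)) ⊆ Set.Ioi 0 := fun x hx =>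
    (hM.quot_pos p).trans_le hx.1
  have hle : quot M p ≤ quot M (p + 1) := hM.quot_monotone p.le_succ
  rw [hmom, Complex.norm_real]
  refine le_trans ?_ (le_abs_self _)
  calc M (p + 1) * (quot M (p + 1) - quot M p) / 2
      = ∫ _ in Set.Icc (quot M p) (quot M (p + 1)), M (p + 1) / 2 := by
        rw [setIntegral_const, Real.volume_real_Icc_of_le hle, smul_eq_mul]
        ring
    _ ≤ ∫ x in Set.Icc (quot M p) (quot M (p + 1)), g x := by
        refine setIntegral_mono_on (integrable_const _) (hgint.mono_set hsub)
          measurableSet_Icc fun x hx => ?_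
        have hx0 : 0 < x := hsub hx
        have hF := hM.series_pos hx0
        have h1 := hM.series_le hx.1 hx.2
        have hp := hM.pos (p + 1)
        rw [hg]
        dsimp only
        rw [← div_eq_mul_inv, div_le_div_iff₀ two_pos hF]
        calc M (p + 1) * ∑' j : ℕ, x ^ j / (2 ^ j * M j)
            ≤ M (p + 1) * (2 * (x ^ (p + 1) / M (p + 1))) := by gcongr
          _ = x ^ (p + 1) * 2 := by field_simp
    _ ≤ ∫ x in Set.Ioi 0, g x := by
        refine setIntegral_mono_set hgint ?_ hsub.eventuallyLE
        filter_upwards [ae_restrict_mem measurableSet_Ioi] with x hx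
        exact mul_nonneg (pow_nonneg (le_of_lt hx) _) (inv_nonneg.2 (hM.series_pos hx).le)

/-! ### Derivation closedness from the moments -/

/-- Geometrically bounded increments of the quotients give a geometric bound on the quotients. -/
lemma isDerivationClosed_of_quot_sub_le {C h : ℝ} (hC : 0 ≤ C) (hh : 0 < h)
    (H : ∀ p, quot M (p + 1) - quot M p ≤ C * h ^ (p + 1)) : IsDerivationClosed M := by
  -- With ratio `h + 2 > 2`, one increment is absorbed in passing from `p` to `p + 1`.
  have hq : ∀ p, quot M p ≤ (quot M 0 + C) * (h + 2) ^ (p + 1) := by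
    have h0 := hM.quot_pos 0
    intro p
    induction p with
    | zero =>
      rw [zero_add, pow_one]
      exact (le_add_of_nonneg_right hC).trans
        (le_mul_of_one_le_right (by positivity) (by linarith))
    | succ p ih =>
      have h1 : h ^ (p + 1) ≤ (h + 2) ^ (p + 1) := by gcongr; linarith
      have h2 : 0 < (h + 2) ^ (p + 1) := by positivity
      calc quot M (p + 1) ≤ quot M p + C * h ^ (p + 1) := by linarith [H p]
        _ ≤ (quot M 0 + C) * (h + 2) ^ (p + 1) + (quot M 0 + C) * (h + 2) ^ (p + 1) := by
            gcongr
            linarith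
        _ = (quot M 0 + C) * (h + 2) ^ (p + 1) * 2 := by ring
        _ ≤ (quot M 0 + C) * (h + 2) ^ (p + 1) * (h + 2) := by gcongr; linarith
        _ = _ := by ring
  refine ⟨quot M 0 + C, h + 2, by linarith [hM.quot_pos 0], by linarith, fun p => ?_⟩
  rw [hM.succ_eq p]
  exact mul_le_mul_of_nonneg_right (hq p) (hM.pos p).le

lemma isDerivationClosed_of_image_subset (hsub : momentMap '' CSpace M ⊆ Lambda M) :
    IsDerivationClosed M := by
  have hmem := hsub ⟨_, hM.invSeries_mem, rfl⟩
  simp only [Lambda, Set.mem_iUnion] at hmem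
  obtain ⟨h, hh, C, hC⟩ := hmem
  have hbound : ∀ p, ‖momentMap hM.invSeries p‖ / (h ^ p * M p) ≤ C := fun p => hC ⟨p, rfl⟩
  have hC0 : 0 ≤ C := le_trans
    (div_nonneg (norm_nonneg _) (mul_pos (pow_pos hh 0) (hM.pos 0)).le) (hbound 0)
  refine hM.isDerivationClosed_of_quot_sub_le (C := 2 * C) (by positivity) hh fun p => ?_
  have hp := hM.pos (p + 1)
  have h1 := hbound (p + 1)
  rw [div_le_iff₀ (by positivity)] at h1
  have h2 := hM.le_norm_momentMap_invSeries p
  refine le_of_mul_le_mul_left ?_ hp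
  linarith

end IsWeightSequence

end StieltjesMoment

theorem mainTheorem7 (M : ℕ → ℝ) (hM : StieltjesMoment.IsWeightSequence M)
    (hγ : 0 < StieltjesMoment.gammaIndex M) :
    (∀ φ ∈ StieltjesMoment.CSpace M, ∀ p : ℕ,
      MeasureTheory.Integrable
        (fun x : Set.Ioi (0 : ℝ) => ((x : ℝ) : ℂ) ^ p * φ x)
        StieltjesMoment.halfLineMeasure) ∧
    (StieltjesMoment.momentMap '' StieltjesMoment.CSpace M ⊆ StieltjesMoment.Lambda M ↔
      StieltjesMoment.IsDerivationClosed M) :=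
  ⟨fun _ hφ p => StieltjesMoment.integrable_moment hM.pos hφ p,
    hM.isDerivationClosed_of_image_subset, StieltjesMoment.image_momentMap_subset hM.pos⟩
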